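/- An mm-space is a complete separable metric space $(X,d_X)$ with a Borel probability measure $\mu_X$ of full support $X=\operatorname{supp}\mu_X$; mm-spaces are considered up to measure-preserving isometry. Write $Y\prec X$ if there is a $1$-Lipschitz map $f:X\to Y$ with $f_*\mu_X=\mu_Y$. The box distance $\square(X,Y)$ is the infimum of $\varepsilon\ge 0$ for which there are Borel maps $\varphi:[0,1)\to X$, $\psi:[0,1)\to Y$ pushing the Lebesgue measure $\mathcal L^1$ forward to $\mu_X$, $\mu_Y$, and a Borel set $I_0\subset[0,1)$ with $\mathcal L^1(I_0)\ge 1-\varepsilon$ and $|d_X(\varphi(s),\varphi(t))-d_Y(\psi(s),\psi(t))|\le\varepsilon$ for all $s,t\in I_0$. A pyramid is a nonempty, $\square$-closed set $\mathcal P$ of mm-spaces (up to isomorphism) such that $Y\prec X\in\mathcal P$ implies $Y\in\mathcal P$, and such that for all $X,X'\in\mathcal P$ there is $Y\in\mathcal P$ with $X\prec Y$ and $X'\prec Y$. Let $*$ be the one-point mm-space and $\mathcal P_*=\{X: X\prec *\}=\{*\}$. A sequence of pyramids $\mathcal P_n$ converges weakly to a pyramid $\mathcal P$ if, with $\square(X,\mathcal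 P_n)=\inf_{Y\in\mathcal P_n}\square(X,Y)$, $\lim_{n\to\infty}\square(X,\mathcal P_n)=0$ for every $X\in\mathcal P$, and $\liminf_{n\to\infty}\square(X,\mathcal P_n)>0$ for every mm-space $X\notin\mathcal P$. For $\kappa>0$ let $\operatorname{ObsDiam}(X;-\kappa)$ be the supremum, over all $1$-Lipschitz $f:X\to\mathbb R$, of $\inf\{\operatorname{diam}A : A\subset\mathbb R \text{ Borel},\ f_*\mu_X(A)\ge 1-\kappa\}$, and let $$\operatorname{ObsDiam}(\mathcal P;-\kappa)=\lim_{\delta\to0+}\ \sup_{X\in\mathcal P}\operatorname{ObsDiam}(X;-(\kappa+\delta))\in[0,+\infty].$$ For $\kappa_0,\kappa_1>0$ let $\operatorname{Sep}(X;\kappa_0,\kappa_1)$ be the supremum of $\inf_{x\in A_0,\,y\in A_1}d_X(x,y)$ over all Borel sets $A_0,A_1\subset X$ with $\mu_X(A_i)\ge\kappa_i$ ($i=0,1$), and $0$ if there are no such sets; let $$\operatorname{Sep}(\mathcal P;\kappa_0,\kappa_1)=\lim_{\delta\to0+}\ \sup_{X\in\mathcal P}\operatorname{Sep}(X;\kappa_0-\delta,\kappa_1-\delta)\in[0,+\infty].$$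 A sequence of pyramids $\{\mathcal P_n\}$ is a Lévy family if $\lim_{n\to\infty}\operatorname{Sep}(\mathcal P_n;\kappa_0,\kappa_1)=0$ for all $\kappa_0,\kappa_1>0$ with $\kappa_0+\kappa_1<1$. **Corollary.** Let $\mathcal P_n$, $n=1,2,\dots$, be pyramids. Then the following are equivalent: 1. $\{\mathcal P_n\}$ is a Lévy family. 2. $\mathcal P_n$ converges weakly to $\mathcal P_*$ as $n\to\infty$. 3. $\lim_{n\to\infty}\operatorname{ObsDiam}(\mathcal P_n;-\kappa)=0$ for every $\kappa>0$. -/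

import Mathlib

open MeasureTheory Filter Topology Set
open scoped ENNReal NNReal

/-- An mm-space: a complete separable metric space with a Borel probability measure
whose support is the whole space.  (A separable metric space has at most continuum many points,
so that up to isomorphism every mm-space has its carrier in `Type`.) -/
structure MMSpace where
  carrier : Type
  [metricSpace : MetricSpace carrier]
  [completeSpace : CompleteSpace carrier]
  [separableSpace : TopologicalSpace.SeparableSpace carrier]
  [measurableSpace : MeasurableSpace carrier]
  [borelSpace : BorelSpace carrier]
  μ : Measure carrier
  [isProbabilityMeasure : IsProbabilityMeasure μ]
  [isOpenPosMeasure : μ.IsOpenPosMeasure]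

namespace MMSpace

instance : CoeSort MMSpace Type := ⟨MMSpace.carrier⟩

attribute [instance] MMSpace.metricSpace MMSpace.completeSpace MMSpace.separableSpace
  MMSpace.measurableSpace MMSpace.borelSpace MMSpace.isProbabilityMeasure
  MMSpace.isOpenPosMeasure

/-- The mm-isomorphism relation: there is an isometry that pushes the measure of `X` forward to
that of `Y` (such an isometry is surjective, as the measures have full support). -/
def Iso (X Y : MMSpace) : Prop :=
  ∃ f : X ≃ᵢ Y, Measure.map f X.μ = Y.μ

/-- The Lipschitz order: `X.Dominates Y` means `Y ≺ X`, that is, there is a `1`-Lipschitz map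
from `X` to `Y` that pushes the measure of `X` forward to that of `Y`. -/
def Dominates (X Y : MMSpace) : Prop :=
  ∃ f : X → Y, LipschitzWith 1 f ∧ Measure.map f X.μ = Y.μ

/-- The partial diameter `diam(ν; α)` of a measure `ν`. -/
noncomputable def partialDiam {S : Type*} [PseudoEMetricSpace S] [MeasurableSpace S]
    (ν : Measure S) (α : ℝ) : ℝ≥0∞ :=
  ⨅ (A : Set S) (_ : MeasurableSet A) (_ : ENNReal.ofReal α ≤ ν A), Metric.ediam A

/-- The observable diameter `ObsDiam(X; -κ)`. -/
noncomputable def obsDiam (X : MMSpace) (κ : ℝ) : ℝ≥0∞ :=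
  ⨆ (f : X → ℝ) (_ : LipschitzWith 1 f), partialDiam (Measure.map f X.μ) (1 - κ)

/-- The distance `d(A, B) = inf {d(x, y) | x ∈ A, y ∈ B}` between two subsets. -/
noncomputable def setDist {S : Type*} [PseudoEMetricSpace S] (A B : Set S) : ℝ≥0∞ :=
  ⨅ (x ∈ A) (y ∈ B), edist x y

/-- The separation distance `Sep(X; κ 0, …, κ N)`: the supremum of `min_{i ≠ j} d(A i, A j)` over
all Borel sets `A 0, …, A N` with `κ i ≤ μ (A i)` for all `i`, and `0` if there are none. -/
noncomputable def sep (X : MMSpace) {N : ℕ} (κ : Fin (N + 1) → ℝ) : ℝ≥0∞ :=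
  ⨆ (A : Fin (N + 1) → Set X) (_ : ∀ i, MeasurableSet (A i))
    (_ : ∀ i, ENNReal.ofReal (κ i) ≤ X.μ (A i)),
    ⨅ (i : Fin (N + 1)) (j : Fin (N + 1)) (_ : i ≠ j), setDist (A i) (A j)

/-- The Lebesgue measure on `[0, 1)`. -/
noncomputable def lebesgueI : Measure (Ico (0 : ℝ) 1) :=
  Measure.comap Subtype.val volume

/-- A parameter of `X`: a Borel map from `[0, 1)` to `X` that pushes the Lebesgue measure
forward to the measure of `X`. -/
def IsParameter (X : MMSpace) (φ : Ico (0 : ℝ) 1 → X) : Prop :=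
  Measurable φ ∧ Measure.map φ lebesgueI = X.μ

/-- The box distance between two mm-spaces. -/
noncomputable def box (X Y : MMSpace) : ℝ≥0∞ :=
  ⨅ (ε : ℝ≥0)
    (_ : ∃ (φ : Ico (0 : ℝ) 1 → X) (ψ : Ico (0 : ℝ) 1 → Y) (I₀ : Set (Ico (0 : ℝ) 1)),
      X.IsParameter φ ∧ Y.IsParameter ψ ∧ MeasurableSet I₀ ∧
      (∀ s ∈ I₀, ∀ t ∈ I₀, |dist (φ s) (φ t) - dist (ψ s) (ψ t)| ≤ (ε : ℝ)) ∧
      ENNReal.ofReal (1 - (ε : ℝ)) ≤ lebesgueI I₀), (ε : ℝ≥0∞)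

/-- The box distance from an mm-space to a family of mm-spaces. -/
noncomputable def boxToSet (X : MMSpace) (P : Set MMSpace) : ℝ≥0∞ :=
  ⨅ Y ∈ P, X.box Y

/-- The one-point mm-space. -/
noncomputable def point : MMSpace where
  carrier := Unit
  μ := Measure.dirac ()
  isOpenPosMeasure := ⟨fun U _ hU => by
    obtain ⟨x, hx⟩ := hU
    simpa using hx⟩

/-- The family `{Y | Y ≺ X}` associated with `X`. -/
def associated (X : MMSpace) : Set MMSpace :=
  {Y | X.Dominates Y}

end MMSpace

/-- A pyramid, as a class of mm-spaces: closed under passing to dominated spaces (hence under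
mm-isomorphism, see `IsPyramid.mem_iff_of_iso`), directed for the Lipschitz order,
nonempty, and closed for the box distance. -/
structure IsPyramid (P : Set MMSpace) : Prop where
  mem_of_dominates : ∀ X ∈ P, ∀ Y : MMSpace, X.Dominates Y → Y ∈ P
  directed : ∀ X ∈ P, ∀ X' ∈ P, ∃ Y ∈ P, MMSpace.Dominates Y X ∧ MMSpace.Dominates Y X'
  nonempty : P.Nonempty
  closed : ∀ X : MMSpace, (∀ ε : ℝ≥0∞, 0 < ε → ∃ Y ∈ P, X.box Y < ε) → X ∈ P

namespace IsPyramid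

theorem mem_iff_of_iso {P : Set MMSpace} (hP : IsPyramid P) {X Y : MMSpace} (h : X.Iso Y) :
    X ∈ P ↔ Y ∈ P := by
  obtain ⟨f, hf⟩ := h
  refine ⟨fun hX => hP.mem_of_dominates X hX Y ⟨f, f.isometry.lipschitz, hf⟩,
    fun hY => hP.mem_of_dominates Y hY X ⟨f.symm, f.symm.isometry.lipschitz, ?_⟩⟩
  rw [← hf, Measure.map_map f.symm.continuous.measurable f.continuous.measurable,
    f.symm_comp_self, Measure.map_id]

end IsPyramid

namespace MMSpace

theorem mem_associated_point (X : MMSpace) : X ∈ point.associated ↔ Subsingleton X := by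
  constructor
  · rintro ⟨f, -, hf⟩
    refine ⟨fun a b => ?_⟩
    have key : ∀ c : X, c = f () := fun c => by
      by_contra hc
      have hpos : 0 < X.μ {f ()}ᶜ :=
        isOpen_compl_singleton.measure_pos X.μ ⟨c, hc⟩
      have hm : Measurable f := measurable_from_top
      rw [← hf, Measure.map_apply hm (measurableSet_singleton _).compl] at hpos
      have he : f ⁻¹' {f ()}ᶜ = ∅ := by
        ext u
        exact ⟨fun h => h rfl, fun h => h.elim⟩
      rw [he] at hpos
      simp at hpos
    rw [key a, key b]
  · intro h
    have hne : Nonempty X := nonempty_of_isProbabilityMeasure X.μ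
    obtain ⟨x⟩ := hne
    refine ⟨fun _ => x, LipschitzWith.const' x, ?_⟩
    have hm : Measurable (fun _ : point => x) := measurable_const
    have : IsProbabilityMeasure (Measure.map (fun _ : point => x) point.μ) :=
      Measure.isProbabilityMeasure_map hm.aemeasurable
    ext s _
    rcases Subsingleton.eq_empty_or_singleton (Set.subsingleton_of_subsingleton (s := s))
      with rfl | ⟨y, rfl⟩
    · simp
    · have hu : ({y} : Set X) = univ := by
        ext z
        simp [Subsingleton.elim z y]
      rw [hu, measure_univ, measure_univ]

/-- The family associated with the one-point mm-space is a pyramid. -/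
theorem isPyramid_associated_point : IsPyramid point.associated where
  mem_of_dominates := by
    intro X hX Y hXY
    rw [mem_associated_point] at hX ⊢
    obtain ⟨f, hl, hf⟩ := hXY
    obtain ⟨g, hgl, hg⟩ := (mem_associated_point X).2 hX
    rw [← mem_associated_point]
    refine ⟨f ∘ g, by simpa using hl.comp hgl, ?_⟩
    rw [← hf, ← hg, Measure.map_map hl.continuous.measurable hgl.continuous.measurable]
  directed := by
    intro X hX X' hX'
    refine ⟨point, ?_, hX, hX'⟩
    exact ⟨id, LipschitzWith.id, Measure.map_id⟩
  nonempty := ⟨point, id, LipschitzWith.id, Measure.map_id⟩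
  closed := by
    intro X hX
    rw [mem_associated_point]
    refine ⟨fun a b => ?_⟩
    by_contra hab
    have hd : 0 < dist a b := dist_pos.2 hab
    have hr : 0 < dist a b / 3 := by positivity
    have ha : 0 < X.μ (Metric.ball a (dist a b / 3)) := Metric.measure_ball_pos X.μ a hr
    have hb : 0 < X.μ (Metric.ball b (dist a b / 3)) := Metric.measure_ball_pos X.μ b hr
    obtain ⟨Y, hY, hlt⟩ := hX (min (ENNReal.ofReal (dist a b / 3))
      (min (X.μ (Metric.ball a (dist a b / 3))) (X.μ (Metric.ball b (dist a b / 3)))))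
      (by simp only [lt_min_iff]; exact ⟨ENNReal.ofReal_pos.2 hr, ha, hb⟩)
    rw [mem_associated_point] at hY
    simp only [box, iInf_lt_iff] at hlt
    obtain ⟨ε, ⟨φ, ψ, I₀, ⟨hφ, hφμ⟩, -, hI, hdist, hvol⟩, hε⟩ := hlt
    simp only [lt_min_iff] at hε
    obtain ⟨h1, h2, h3⟩ := hε
    have meets : ∀ c : X, (ε : ℝ≥0∞) < X.μ (Metric.ball c (dist a b / 3)) →
        ∃ s ∈ I₀, φ s ∈ Metric.ball c (dist a b / 3) := by
      intro c hc
      by_contra! hcon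
      have hsub : φ ⁻¹' Metric.ball c (dist a b / 3) ⊆ I₀ᶜ :=
        fun s hs hs' => hcon s hs' hs
      have hI1 : lebesgueI univ = 1 := by
        rw [← X.isProbabilityMeasure.measure_univ, ← hφμ,
          Measure.map_apply hφ MeasurableSet.univ, preimage_univ]
      have hle : X.μ (Metric.ball c (dist a b / 3)) ≤ lebesgueI I₀ᶜ := by
        rw [← hφμ, Measure.map_apply hφ measurableSet_ball]
        exact measure_mono hsub
      have hsum : lebesgueI I₀ + lebesgueI I₀ᶜ = 1 := by
        rw [measure_add_measure_compl hI, hI1]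
      have hone : (1 : ℝ≥0∞) ≤ lebesgueI I₀ + ε := by
        calc (1 : ℝ≥0∞) = ENNReal.ofReal ((1 - (ε : ℝ)) + ε) := by simp
          _ ≤ ENNReal.ofReal (1 - (ε : ℝ)) + ENNReal.ofReal (ε : ℝ) := ENNReal.ofReal_add_le
          _ ≤ lebesgueI I₀ + ε := by
            gcongr
            simp
      have hfin : lebesgueI I₀ ≠ ∞ := fun h => by simp [h] at hsum
      rw [← hsum] at hone
      have := (ENNReal.add_le_add_iff_left hfin).1 hone
      exact absurd (hc.trans_le (hle.trans this)) (lt_irrefl _)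
    obtain ⟨s, hs, hsa⟩ := meets a h2
    obtain ⟨t, ht, htb⟩ := meets b h3
    have h4 := hdist s hs t ht
    rw [Subsingleton.elim (ψ s) (ψ t), dist_self, sub_zero, abs_of_nonneg dist_nonneg] at h4
    have h5 : (ε : ℝ) < dist a b / 3 := by
      rw [← ENNReal.ofReal_coe_nnreal] at h1
      exact (ENNReal.ofReal_lt_ofReal_iff hr).1 h1
    rw [Metric.mem_ball] at hsa htb
    have h6 := dist_triangle4 a (φ s) (φ t) b
    rw [dist_comm a (φ s)] at h6
    linarith

theorem obsDiam_antitone (X : MMSpace) : Antitone X.obsDiam := by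
  intro κ κ' h
  refine iSup₂_mono fun f _ => iInf₂_mono fun A _ => iInf_mono' fun hA => ⟨?_, le_rfl⟩
  exact (ENNReal.ofReal_le_ofReal (by linarith)).trans hA

theorem sep_antitone (X : MMSpace) {N : ℕ} :
    Antitone (fun κ : Fin (N + 1) → ℝ => X.sep κ) := by
  intro κ κ' h
  refine iSup₂_mono fun A _ => iSup_mono' fun hA => ⟨fun i => ?_, le_rfl⟩
  exact (ENNReal.ofReal_le_ofReal (h i)).trans (hA i)

end MMSpace

namespace Pyramid

/-- The observable diameter of a pyramid,
`ObsDiam(P; -κ) = lim_{δ → 0+} sup_{X ∈ P} ObsDiam(X; -(κ + δ))`. -/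
noncomputable def obsDiam (P : Set MMSpace) (κ : ℝ) : ℝ≥0∞ :=
  limUnder (𝓝[>] (0 : ℝ)) fun δ => ⨆ X ∈ P, MMSpace.obsDiam X (κ + δ)

/-- The limit in the definition of the observable diameter exists. -/
theorem tendsto_obsDiam (P : Set MMSpace) (κ : ℝ) :
    Tendsto (fun δ : ℝ => ⨆ X ∈ P, MMSpace.obsDiam X (κ + δ)) (𝓝[>] 0) (𝓝 (obsDiam P κ)) := by
  refine tendsto_nhds_limUnder ⟨_, Antitone.tendsto_nhdsGT (fun δ δ' h => ?_) 0⟩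
  exact iSup₂_mono fun X _ => X.obsDiam_antitone (by linarith)

/-- The separation distance of a pyramid,
`Sep(P; κ 0, …, κ N) = lim_{δ → 0+} sup_{X ∈ P} Sep(X; κ 0 - δ, …, κ N - δ)`. -/
noncomputable def sep (P : Set MMSpace) {N : ℕ} (κ : Fin (N + 1) → ℝ) : ℝ≥0∞ :=
  limUnder (𝓝[>] (0 : ℝ)) fun δ => ⨆ X ∈ P, MMSpace.sep X (fun i => κ i - δ)

/-- The limit in the definition of the separation distance exists. -/
theorem tendsto_sep (P : Set MMSpace) {N : ℕ} (κ : Fin (N + 1) → ℝ) :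
    Tendsto (fun δ : ℝ => ⨆ X ∈ P, MMSpace.sep X (fun i => κ i - δ)) (𝓝[>] 0)
      (𝓝 (sep P κ)) := by
  refine tendsto_nhds_limUnder ⟨_, Monotone.tendsto_nhdsGT (fun δ δ' h => ?_) 0⟩
  refine iSup₂_mono fun X _ => X.sep_antitone fun i => ?_
  dsimp only
  linarith

/-- An `N`-Lévy family of pyramids. -/
def IsNLevyFamily (N : ℕ) (P : ℕ → Set MMSpace) : Prop :=
  ∀ κ : Fin (N + 1) → ℝ, (∀ i, 0 < κ i) → ∑ i, κ i < 1 →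
    Tendsto (fun n => sep (P n) κ) atTop (𝓝 0)

/-- A Lévy family of pyramids is a `1`-Lévy family. -/
def IsLevyFamily (P : ℕ → Set MMSpace) : Prop :=
  IsNLevyFamily 1 P

/-- Weak convergence of a sequence of pyramids `P n` to a pyramid `Q`. -/
def ConvergesWeakly (P : ℕ → Set MMSpace) (Q : Set MMSpace) : Prop :=
  (∀ X ∈ Q, Tendsto (fun n => MMSpace.boxToSet X (P n)) atTop (𝓝 0)) ∧
  (∀ X : MMSpace, X ∉ Q → 0 < liminf (fun n => MMSpace.boxToSet X (P n)) atTop)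

end Pyramid

/-!
The equivalence of the Lévy property with the vanishing of observable diameters is a two-sided
comparison on each mm-space: `ObsDiam(X; -κ) ≤ Sep(X; κ/2, κ/2)`, by cutting the two tails off the
law of a `1`-Lipschitz function (`MMSpace.obsDiam_le_sep`), and `Sep(X; κ₀, κ₁) ≤ ObsDiam(X; -κ')`
for `κ' < κ₀, κ₁`, by testing with the distance function of one of two separated sets
(`MMSpace.sep_le_obsDiam`).  The limits in the definitions for pyramids cost only an arbitrarily
small change of the thresholds.

A Lévy family converges weakly to the one-point pyramid because a space with two points has two
separated balls of positive measure, which a box-close space inherits up to a small loss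
(`MMSpace.exists_le_sep_of_box_lt`).

Conversely, suppose that infinitely many of the pyramids contain spaces with separated sets of mass
at least `c` at distance more than `r`.  The truncated distance functions map them to spaces on
`[0, r]` with atoms of mass at least `c` at both ends, which belong to the pyramids as well.  Their
quantile functions are monotone and uniformly bounded, so Helly selection gives a subsequence that
converges almost everywhere, hence in measure; quantile functions being parameters, the
corresponding spaces converge in the box distance.  The limit has atoms at `0` and at `r`
(`MMSpace.exists_subseq_box_tendsto`), so it is a space outside the one-point pyramid whose
distance to the pyramids has lower limit `0`.
-/

open ProbabilityTheory MMSpace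

/-! ### Lebesgue measure on the unit interval -/

namespace MMSpace

theorem lebesgueI_apply (s : Set (Ico (0 : ℝ) 1)) :
    lebesgueI s = volume (Subtype.val '' s) :=
  (MeasurableEmbedding.subtype_coe measurableSet_Ico).comap_apply _ _

instance : IsProbabilityMeasure lebesgueI :=
  ⟨by rw [lebesgueI_apply, image_univ, Subtype.range_coe]; simp⟩

instance : NullSingletonClass lebesgueI :=
  ⟨fun t => by rw [lebesgueI_apply]; simp⟩

theorem lebesgueI_le {c : ℝ} (hc1 : c ≤ 1) :
    lebesgueI {t | (t : ℝ) ≤ c} = ENNReal.ofReal c := by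
  rw [lebesgueI_apply]
  refine le_antisymm ?_ ?_
  · refine (measure_mono (t := Icc 0 c) ?_).trans (by simp)
    rintro _ ⟨t, ht, rfl⟩
    exact ⟨t.2.1, ht⟩
  · refine le_trans (by simp) (measure_mono (s := Ico 0 c) ?_)
    intro t ht
    exact ⟨⟨t, ht.1, ht.2.trans_le hc1⟩, ht.2.le, rfl⟩

theorem ae_pos_lebesgueI : ∀ᵐ t : Ico (0 : ℝ) 1 ∂lebesgueI, 0 < (t : ℝ) := by
  have h : ∀ᵐ t ∂lebesgueI, t ≠ ⟨0, by simp⟩ := compl_mem_ae_iff.2 (measure_singleton _)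
  filter_upwards [h] with t ht
  exact lt_of_le_of_ne t.2.1 fun h => ht (Subtype.ext h.symm)

theorem exists_mem_of_ae_lebesgueI {p : Ico (0 : ℝ) 1 → Prop} (hp : ∀ᵐ t ∂lebesgueI, p t)
    {a b : ℝ} (ha : 0 ≤ a) (hb : b ≤ 1) (hab : a < b) :
    ∃ t : Ico (0 : ℝ) 1, a < t ∧ (t : ℝ) < b ∧ p t := by
  by_contra! h
  have h0 : lebesgueI {t | ¬ p t} = 0 := ae_iff.1 hp
  have h1 : volume (Ioo a b) ≤ lebesgueI {t | ¬ p t} := by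
    rw [lebesgueI_apply]
    refine measure_mono fun t ht => ?_
    exact ⟨⟨t, ha.trans ht.1.le, ht.2.trans_le hb⟩, h _ ht.1 ht.2, rfl⟩
  rw [h0, Real.volume_Ioo, nonpos_iff_eq_zero, ENNReal.ofReal_eq_zero] at h1
  linarith

end MMSpace

/-! ### Quantile functions -/

/-- The quantile function `t ↦ inf {x | t ≤ ν (-∞, x]}` of a probability measure on the line.
It is meaningful for `0 < t < 1`; at `t = 0` its value is the infimum of `ℝ`, that is, `0`. -/
noncomputable def quantile (ν : Measure ℝ) (t : ℝ) : ℝ :=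
  sInf {x | t ≤ cdf ν x}

section Quantile

variable (ν : Measure ℝ)

theorem quantile_zero : quantile ν 0 = 0 := by
  have : {x | (0 : ℝ) ≤ cdf ν x} = univ := eq_univ_of_forall fun x => cdf_nonneg ν x
  rw [quantile, this, Real.sInf_univ]

theorem bddBelow_le_cdf {t : ℝ} (ht : 0 < t) : BddBelow {x | t ≤ cdf ν x} := by
  obtain ⟨y, hy⟩ := ((tendsto_cdf_atBot ν).eventually (gt_mem_nhds ht)).exists
  refine ⟨y, fun x hx => le_of_lt ?_⟩
  by_contra! h
  exact absurd (hx.trans (monotone_cdf ν h)) (not_le.2 hy)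

theorem nonempty_le_cdf {t : ℝ} (ht : t < 1) : {x | t ≤ cdf ν x}.Nonempty := by
  obtain ⟨y, hy⟩ := ((tendsto_cdf_atTop ν).eventually (lt_mem_nhds ht)).exists
  exact ⟨y, hy.le⟩

theorem le_cdf_quantile {t : ℝ} (h0 : 0 < t) (h1 : t < 1) : t ≤ cdf ν (quantile ν t) := by
  have hr : Tendsto (cdf ν) (𝓝[>] quantile ν t) (𝓝 (cdf ν (quantile ν t))) :=
    ((cdf ν).right_continuous _).mono_left (nhdsWithin_mono _ Ioi_subset_Ici_self)
  refine ge_of_tendsto hr ?_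
  filter_upwards [self_mem_nhdsWithin] with x hx
  obtain ⟨y, hy, hyx⟩ := (csInf_lt_iff (bddBelow_le_cdf ν h0) (nonempty_le_cdf ν h1)).1 hx
  exact le_trans hy (monotone_cdf ν hyx.le)

theorem quantile_le_iff {t : ℝ} (h0 : 0 < t) (h1 : t < 1) (x : ℝ) :
    quantile ν t ≤ x ↔ t ≤ cdf ν x :=
  ⟨fun h => (le_cdf_quantile ν h0 h1).trans (monotone_cdf ν h),
    fun h => csInf_le (bddBelow_le_cdf ν h0) h⟩

variable [IsProbabilityMeasure ν]

theorem measure_Iio_quantile_le {t : ℝ} (h0 : 0 < t) (h1 : t < 1) :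
    ν.real (Iio (quantile ν t)) ≤ t := by
  have h : ν (Iio (quantile ν t)) ≤ ENNReal.ofReal t := by
    rw [← measure_cdf ν, StieltjesFunction.measure_Iio _ (tendsto_cdf_atBot ν), sub_zero,
      measure_cdf]
    refine ENNReal.ofReal_le_ofReal (le_of_tendsto ((monotone_cdf ν).tendsto_leftLim _) ?_)
    filter_upwards [self_mem_nhdsWithin] with x hx
    exact le_of_not_ge fun h => absurd ((quantile_le_iff ν h0 h1 x).2 h) (not_le.2 hx)
  exact ENNReal.toReal_le_of_le_ofReal h0.le h

/-- If `ν` lives on the half-line, then so does its quantile function. -/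
theorem quantile_nonneg (hν : ν (Iio 0) = 0) {t : ℝ} (h0 : 0 ≤ t) (h1 : t < 1) :
    0 ≤ quantile ν t := by
  rcases h0.eq_or_lt with rfl | h0
  · exact (quantile_zero ν).ge
  · by_contra! h
    have h2 : ν.real (Iic (quantile ν t)) = 0 := by
      rw [measureReal_def, measure_mono_null (Iic_subset_Iio.2 h) hν, ENNReal.toReal_zero]
    have h3 := le_cdf_quantile ν h0 h1
    rw [cdf_eq_real, h2] at h3
    linarith

theorem quantile_monotone (hν : ν (Iio 0) = 0) :
    Monotone fun t : Ico (0 : ℝ) 1 => quantile ν t := by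
  intro s t hst
  rcases s.2.1.eq_or_lt with h | h
  · dsimp only
    rw [← h, quantile_zero]
    exact quantile_nonneg ν hν t.2.1 t.2.2
  · refine (quantile_le_iff ν h s.2.2 _).2 (le_trans hst ?_)
    exact le_cdf_quantile ν (h.trans_le hst) t.2.2

/-- The quantile function pushes the Lebesgue measure of `[0, 1)` forward to `ν`. -/
theorem map_quantile (hν : ν (Iio 0) = 0) :
    Measure.map (fun t : Ico (0 : ℝ) 1 => quantile ν t) lebesgueI = ν := by
  have hm : Measurable fun t : Ico (0 : ℝ) 1 => quantile ν t := (quantile_monotone ν hν).measurable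
  have : IsProbabilityMeasure (Measure.map (fun t : Ico (0 : ℝ) 1 => quantile ν t) lebesgueI) :=
    Measure.isProbabilityMeasure_map hm.aemeasurable
  refine Measure.ext_of_Iic _ _ fun a => ?_
  rw [Measure.map_apply hm measurableSet_Iic, ← ofReal_cdf,
    ← lebesgueI_le (cdf_le_one ν a)]
  refine measure_congr ?_
  filter_upwards [ae_pos_lebesgueI] with t ht
  exact propext (quantile_le_iff ν ht t.2.2 a)

theorem quantile_le_of_measure_Ioi {r : ℝ} (hr : 0 ≤ r) (hν : ν (Ioi r) = 0) {t : ℝ} (h0 : 0 ≤ t)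
    (h1 : t < 1) : quantile ν t ≤ r := by
  rcases h0.eq_or_lt with rfl | h0
  · rwa [quantile_zero]
  · rw [quantile_le_iff ν h0 h1, cdf_eq_real, ← compl_Ioi,
      probReal_compl_eq_one_sub measurableSet_Ioi, measureReal_def, hν]
    simpa using h1.le

theorem quantile_le_of_le_measure_singleton {a c : ℝ} (hν : c ≤ ν.real {a}) {t : ℝ} (h0 : 0 < t)
    (h1 : t < 1) (htc : t ≤ c) : quantile ν t ≤ a := by
  rw [quantile_le_iff ν h0 h1, cdf_eq_real]
  exact htc.trans (hν.trans (measureReal_mono (by simp)))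

theorem le_quantile_of_le_measure_singleton {a c : ℝ} (hν : c ≤ ν.real {a}) {t : ℝ} (h0 : 0 < t)
    (h1 : t < 1) (htc : 1 - c < t) : a ≤ quantile ν t := by
  by_contra! h
  have h2 := le_cdf_quantile ν h0 h1
  have h3 : ν.real (Iic (quantile ν t)) ≤ ν.real {a}ᶜ :=
    measureReal_mono fun x hx hxa => absurd (hxa ▸ hx : a ≤ quantile ν t) (not_le.2 h)
  rw [probReal_compl_eq_one_sub (measurableSet_singleton a)] at h3
  rw [cdf_eq_real] at h2
  linarith

end Quantile

/-! ### Helly selection -/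

/-- **Helly's selection theorem**: uniformly bounded monotone functions on `[0, 1)` have an
almost everywhere convergent subsequence, and the limit is monotone.  The subsequence converges
on a countable dense set, hence at every continuity point `t ≠ 0` of the limit. -/
theorem exists_subseq_tendsto_ae_of_monotone {q : ℕ → Ico (0 : ℝ) 1 → ℝ} {r : ℝ}
    (hmono : ∀ n, Monotone (q n)) (hq : ∀ n t, q n t ∈ Icc 0 r) :
    ∃ (φ : ℕ → ℕ) (g : Ico (0 : ℝ) 1 → ℝ), StrictMono φ ∧ Monotone g ∧
      ∀ᵐ t ∂lebesgueI, Tendsto (fun n => q (φ n) t) atTop (𝓝 (g t)) := by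
  obtain ⟨D, hDc, hDd⟩ := TopologicalSpace.exists_countable_dense (Ico (0 : ℝ) 1)
  have : Countable D := hDc.to_subtype
  have : Nonempty (Ico (0 : ℝ) 1) := ⟨⟨0, by simp⟩⟩
  have : Nonempty D := hDd.nonempty.to_subtype
  obtain ⟨l, hl, φ, hφ, hlim⟩ := (isCompact_univ_pi fun _ : D => isCompact_Icc).isSeqCompact
    (x := fun n (d : D) => q n d) (fun n d _ => hq n d)
  rw [tendsto_pi_nhds] at hlim
  have hl0 : ∀ d, 0 ≤ l d := fun d => (hl d trivial).1
  have hlr : ∀ d, l d ≤ r := fun d => (hl d trivial).2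
  have hlmono : ∀ d e : D, d ≤ e → l d ≤ l e := fun d e h =>
    le_of_tendsto_of_tendsto' (hlim d) (hlim e) fun n => hmono _ h
  classical
  let g : Ico (0 : ℝ) 1 → ℝ := fun t => ⨆ d : D, if (d : Ico (0 : ℝ) 1) ≤ t then l d else 0
  have hle : ∀ t (d : D), (if (d : Ico (0 : ℝ) 1) ≤ t then l d else 0) ≤ r := fun t d => by
    split_ifs
    · exact hlr d
    · exact (hl0 d).trans (hlr d)
  have hbdd : ∀ t, BddAbove (range fun d : D => if (d : Ico (0 : ℝ) 1) ≤ t then l d else 0) :=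
    fun t => ⟨r, by rintro _ ⟨d, rfl⟩; exact hle t d⟩
  have hg : Monotone g := by
    refine fun s t hst => ciSup_mono (hbdd t) fun d => ?_
    split_ifs with h1 h2 h2
    · exact le_rfl
    · exact absurd (h1.trans hst) h2
    · exact hl0 d
    · exact le_rfl
  have hgD : ∀ d : D, g d = l d := fun d => by
    refine le_antisymm (ciSup_le fun e => ?_) ?_
    · split_ifs with h
      · exact hlmono e d h
      · exact hl0 d
    · refine le_trans ?_ (le_ciSup (hbdd d) d)
      simp
  refine ⟨φ, g, hφ, hg, ?_⟩
  filter_upwards [hg.countable_not_continuousAt.ae_notMem lebesgueI, ae_pos_lebesgueI] with t ht ht0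
  have hcont : ContinuousAt g t := not_not.1 ht
  have hlo : ∃ s, s < t := ⟨⟨0, by simp⟩, ht0⟩
  have hhi : ∃ s, t < s := ⟨⟨(t + 1) / 2, by linarith [t.2.1], by linarith [t.2.2]⟩,
    show (t : ℝ) < (t + 1) / 2 by linarith [t.2.2]⟩
  refine tendsto_order.2 ⟨fun a ha => ?_, fun a ha => ?_⟩
  · obtain ⟨u, v, htuv, huv⟩ := (mem_nhds_iff_exists_Ioo_subset' hlo hhi).1
      (hcont.eventually (lt_mem_nhds ha))
    obtain ⟨d, hd, hud, hdt⟩ := hDd.exists_between htuv.1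
    have h1 : a < l ⟨d, hd⟩ := hgD ⟨d, hd⟩ ▸ huv ⟨hud, hdt.trans htuv.2⟩
    filter_upwards [(hlim ⟨d, hd⟩).eventually (lt_mem_nhds h1)] with n hn
    exact lt_of_lt_of_le hn (hmono _ hdt.le)
  · obtain ⟨u, v, htuv, huv⟩ := (mem_nhds_iff_exists_Ioo_subset' hlo hhi).1
      (hcont.eventually (gt_mem_nhds ha))
    obtain ⟨d, hd, htd, hdv⟩ := hDd.exists_between htuv.2
    have h1 : l ⟨d, hd⟩ < a := hgD ⟨d, hd⟩ ▸ huv ⟨htuv.1.trans htd, hdv⟩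
    filter_upwards [(hlim ⟨d, hd⟩).eventually (gt_mem_nhds h1)] with n hn
    exact lt_of_le_of_lt (hmono _ htd.le) hn

/-! ### mm-spaces on the real line -/

namespace MMSpace

/-- The mm-space given by a probability measure on the real line: its carrier is the support of
the measure. -/
noncomputable def ofMeasure (ν : Measure ℝ) [IsProbabilityMeasure ν] : MMSpace where
  carrier := ν.support
  completeSpace := Measure.isClosed_support.completeSpace_coe
  μ := Measure.comap Subtype.val ν
  isProbabilityMeasure := ⟨by
    rw [(MeasurableEmbedding.subtype_coe Measure.isClosed_support.measurableSet).comap_apply,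
      image_univ, Subtype.range_coe]
    exact (prob_compl_eq_zero_iff Measure.isClosed_support.measurableSet).1
      Measure.measure_compl_support⟩
  isOpenPosMeasure := ⟨fun U hU hne => by
    obtain ⟨V, hV, rfl⟩ := isOpen_induced_iff.1 hU
    obtain ⟨x, hx⟩ := hne
    rw [(MeasurableEmbedding.subtype_coe Measure.isClosed_support.measurableSet).comap_apply,
      Subtype.image_preimage_coe, inter_comm, measure_inter_conull Measure.measure_compl_support]
    exact ((Measure.mem_support_iff_forall _).1 x.2 V (hV.mem_nhds hx)).ne'⟩

/-- Measurability and law of a map into `ofMeasure ν` can be checked after inclusion into `ℝ`. -/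
theorem map_eq_ofMeasure_μ {Ω : Type*} [MeasurableSpace Ω] {m : Measure Ω} {ν : Measure ℝ}
    [IsProbabilityMeasure ν] {f : Ω → ofMeasure ν}
    (hf : Measurable fun x => (f x : ν.support).1)
    (hν : Measure.map (fun x => (f x : ν.support).1) m = ν) :
    Measurable f ∧ Measure.map f m = (ofMeasure ν).μ := by
  have hm : Measurable f := Measurable.subtype_mk hf
  refine ⟨hm, Measure.ext fun s hs => ?_⟩
  have he := MeasurableEmbedding.subtype_coe
    (Measure.isClosed_support (μ := ν)).measurableSet
  have h1 : (ofMeasure ν).μ s = ν (Subtype.val '' (s : Set ν.support)) := he.comap_apply _ _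
  have h2 : ν (Subtype.val '' (s : Set ν.support)) =
      m ((fun x => (f x : ν.support).1) ⁻¹' (Subtype.val '' (s : Set ν.support))) := by
    have h3 := Measure.map_apply (μ := m) hf (he.measurableSet_image.2 hs)
    rwa [hν] at h3
  rw [h1, h2, Measure.map_apply hm hs]
  congr 1
  ext x
  exact (Subtype.val_injective.mem_set_image (s := (s : Set ν.support)) (a := f x)).symm

theorem dominates_ofMeasure (X : MMSpace) {f : X → ℝ} (hf : LipschitzWith 1 f) {ν : Measure ℝ}
    [IsProbabilityMeasure ν] (hν : Measure.map f X.μ = ν) : X.Dominates (ofMeasure ν) := by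
  have hmem : ∀ x, f x ∈ ν.support := fun x => by
    refine (Measure.mem_support_iff_forall _).2 fun U hU => ?_
    rw [← hν]
    exact (Measure.measure_pos_of_mem_nhds X.μ (hf.continuous.continuousAt hU)).trans_le
      (Measure.le_map_apply hf.continuous.measurable.aemeasurable U)
  refine ⟨fun x => (⟨f x, hmem x⟩ : ν.support), fun x y => hf x y, ?_⟩
  exact (map_eq_ofMeasure_μ (ν := ν) (f := fun x => (⟨f x, hmem x⟩ : ν.support))
    hf.continuous.measurable hν).2

/-- Any real random variable on `[0, 1)` is, off a null set, a parameter of its law. -/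
theorem exists_isParameter_ofMeasure {q : Ico (0 : ℝ) 1 → ℝ} (hq : Measurable q)
    {ν : Measure ℝ} [IsProbabilityMeasure ν] (hν : Measure.map q lebesgueI = ν) :
    ∃ φ : Ico (0 : ℝ) 1 → ofMeasure ν, (ofMeasure ν).IsParameter φ ∧
      ∀ᵐ t ∂lebesgueI, (φ t : ν.support).1 = q t := by
  classical
  obtain ⟨x₀, hx₀⟩ := Measure.nonempty_support (IsProbabilityMeasure.ne_zero ν)
  have hmS : MeasurableSet ν.support := Measure.isClosed_support.measurableSet
  have hae : ∀ᵐ t ∂lebesgueI, q t ∈ ν.support := by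
    refine ae_of_ae_map hq.aemeasurable (p := fun x => x ∈ ν.support) ?_
    rw [hν]
    exact Measure.support_mem_ae
  let φ : Ico (0 : ℝ) 1 → ν.support := fun t =>
    if h : q t ∈ ν.support then ⟨q t, h⟩ else ⟨x₀, hx₀⟩
  have hφ : (fun t => (φ t).1) = fun t => if q t ∈ ν.support then q t else x₀ := by
    ext t
    dsimp only [φ]
    split_ifs <;> rfl
  have hφae : ∀ᵐ t ∂lebesgueI, (φ t).1 = q t := by
    filter_upwards [hae] with t ht
    simp [φ, ht]
  have hφm : Measurable fun t => (φ t).1 := by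
    rw [hφ]
    exact Measurable.ite (hq hmS) hq measurable_const
  refine ⟨φ, map_eq_ofMeasure_μ (ν := ν) (f := φ) hφm ?_, hφae⟩
  exact (Measure.map_congr hφae).trans hν

/-- Convergence in measure bounds the box distance between laws on the line. -/
theorem box_ofMeasure_le {q q' : Ico (0 : ℝ) 1 → ℝ} (hq : Measurable q) (hq' : Measurable q')
    {ν ν' : Measure ℝ} [IsProbabilityMeasure ν] [IsProbabilityMeasure ν']
    (hν : Measure.map q lebesgueI = ν) (hν' : Measure.map q' lebesgueI = ν') {ε : ℝ≥0}
    (h : lebesgueI {t | (ε : ℝ) / 2 ≤ dist (q' t) (q t)} ≤ ε) :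
    (ofMeasure ν).box (ofMeasure ν') ≤ ε := by
  obtain ⟨φ, hφ, hφq⟩ := exists_isParameter_ofMeasure hq hν
  obtain ⟨ψ, hψ, hψq⟩ := exists_isParameter_ofMeasure hq' hν'
  let φ' : Ico (0 : ℝ) 1 → ℝ := fun t => (φ t : ν.support).1
  let ψ' : Ico (0 : ℝ) 1 → ℝ := fun t => (ψ t : ν'.support).1
  have hφm : Measurable φ' := measurable_subtype_coe.comp (hφ.1 : @Measurable _ ν.support _ _ φ)
  have hψm : Measurable ψ' := measurable_subtype_coe.comp (hψ.1 : @Measurable _ ν'.support _ _ ψ)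
  have hB : MeasurableSet {t | (ε : ℝ) / 2 ≤ dist (ψ' t) (φ' t)} :=
    measurableSet_le measurable_const (hψm.dist hφm)
  have hBε : lebesgueI {t | (ε : ℝ) / 2 ≤ dist (ψ' t) (φ' t)} ≤ ε := by
    refine le_of_eq_of_le (measure_congr ?_) h
    filter_upwards [hφq, hψq] with t h1 h2
    change ((ε : ℝ) / 2 ≤ dist (ψ' t) (φ' t)) = ((ε : ℝ) / 2 ≤ dist (q' t) (q t))
    rw [show φ' t = q t from h1, show ψ' t = q' t from h2]
  refine iInf₂_le_of_le ε ⟨φ, ψ, {t | (ε : ℝ) / 2 ≤ dist (ψ' t) (φ' t)}ᶜ, hφ, hψ, hB.compl,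
    ?_, ?_⟩ le_rfl
  · intro s hs t ht
    have hs' : dist (ψ' s) (φ' s) < ε / 2 := not_le.1 hs
    have ht' : dist (ψ' t) (φ' t) < ε / 2 := not_le.1 ht
    change |dist (φ' s) (φ' t) - dist (ψ' s) (ψ' t)| ≤ ε
    have h1 := dist_triangle4 (φ' s) (ψ' s) (ψ' t) (φ' t)
    have h2 := dist_triangle4 (ψ' s) (φ' s) (φ' t) (ψ' t)
    rw [dist_comm (φ' s) (ψ' s)] at h1
    rw [dist_comm (φ' t) (ψ' t)] at h2
    rw [abs_le]
    constructor <;> linarith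
  · rw [prob_compl_eq_one_sub hB, ENNReal.ofReal_sub _ ε.coe_nonneg, ENNReal.ofReal_one,
      ENNReal.ofReal_coe_nnreal]
    exact tsub_le_tsub_left hBε 1

end MMSpace

/-! ### Observable diameter and separation distance of an mm-space -/

namespace MMSpace

theorem exists_sets_of_lt_sep {X : MMSpace} {κ : Fin 2 → ℝ} {r : ℝ≥0∞} (h : r < X.sep κ) :
    ∃ A B : Set X, MeasurableSet A ∧ MeasurableSet B ∧ ENNReal.ofReal (κ 0) ≤ X.μ A ∧
      ENNReal.ofReal (κ 1) ≤ X.μ B ∧ ∀ x ∈ A, ∀ y ∈ B, r < edist x y := by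
  simp only [sep, lt_iSup_iff] at h
  obtain ⟨A, hA, hκ, h⟩ := h
  refine ⟨A 0, A 1, hA 0, hA 1, hκ 0, hκ 1, fun x hx y hy => h.trans_le ?_⟩
  refine iInf_le_of_le 0 (iInf_le_of_le 1 (iInf_le_of_le (by simp) ?_))
  exact iInf₂_le_of_le x hx (iInf₂_le y hy)

theorem le_sep {X : MMSpace} {κ : Fin 2 → ℝ} {r : ℝ≥0∞} {A B : Set X} (hA : MeasurableSet A)
    (hB : MeasurableSet B) (hκA : ENNReal.ofReal (κ 0) ≤ X.μ A)
    (hκB : ENNReal.ofReal (κ 1) ≤ X.μ B) (h : ∀ x ∈ A, ∀ y ∈ B, r ≤ edist x y) :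
    r ≤ X.sep κ := by
  refine le_iSup_of_le ![A, B] (le_iSup₂_of_le (fun i => ?_) (fun i => ?_) ?_)
  · fin_cases i <;> assumption
  · fin_cases i <;> assumption
  · refine le_iInf fun i => le_iInf fun j => le_iInf fun hij => ?_
    refine le_iInf₂ fun x hx => le_iInf₂ fun y hy => ?_
    fin_cases i <;> fin_cases j
    · exact absurd rfl hij
    · exact h x hx y hy
    · rw [edist_comm]
      exact h y hy x hx
    · exact absurd rfl hij

/-- Cutting off mass `κ / 2` at each end of the law of a `1`-Lipschitz function leaves an interval
whose two ends are images of separated sets. -/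
theorem obsDiam_le_sep (X : MMSpace) {κ : ℝ} (h0 : 0 < κ) (h1 : κ < 1) :
    X.obsDiam κ ≤ X.sep fun _ : Fin 2 => κ / 2 := by
  refine iSup₂_le fun f hf => ?_
  have hfm : Measurable f := hf.continuous.measurable
  set ν := Measure.map f X.μ
  have : IsProbabilityMeasure ν := Measure.isProbabilityMeasure_map hfm.aemeasurable
  have hκ0 : 0 < κ / 2 := by linarith
  have hκ1 : κ / 2 < 1 := by linarith
  have hκ2 : 0 < 1 - κ / 2 := by linarith
  have hκ3 : 1 - κ / 2 < 1 := by linarith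
  set a := quantile ν (κ / 2)
  set b := quantile ν (1 - κ / 2)
  have ha : κ / 2 ≤ ν.real (Iic a) := by
    rw [← cdf_eq_real]
    exact le_cdf_quantile ν hκ0 hκ1
  have ha' : ν.real (Iio a) ≤ κ / 2 := measure_Iio_quantile_le ν hκ0 hκ1
  have hb : 1 - κ / 2 ≤ ν.real (Iic b) := by
    rw [← cdf_eq_real]
    exact le_cdf_quantile ν hκ2 hκ3
  have hb' : κ / 2 ≤ ν.real (Ici b) := by
    have := measure_Iio_quantile_le ν hκ2 hκ3
    rw [← compl_Iio, probReal_compl_eq_one_sub measurableSet_Iio]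
    linarith
  have hIcc : 1 - κ ≤ ν.real (Icc a b) := by
    have h2 : ν.real (Iic b) ≤ ν.real (Iio a) + ν.real (Icc a b) :=
      (measureReal_mono fun x hx => (lt_or_ge x a).imp id fun h => ⟨h, hx⟩).trans
        (measureReal_union_le _ _)
    linarith
  have hab : a ≤ b := by
    by_contra! h
    rw [Icc_eq_empty (not_le.2 h), measureReal_empty] at hIcc
    linarith
  have hofReal : ∀ {c : ℝ} {s : Set ℝ}, MeasurableSet s → c ≤ ν.real s →
      ENNReal.ofReal c ≤ X.μ (f ⁻¹' s) := fun hs h => by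
    rw [← Measure.map_apply hfm hs]
    exact ENNReal.ofReal_le_of_le_toReal h
  refine (iInf_le_of_le (Icc a b) (iInf₂_le_of_le measurableSet_Icc
    (ENNReal.ofReal_le_of_le_toReal hIcc) (Real.ediam_Icc a b).le)).trans ?_
  refine le_sep (hfm measurableSet_Iic) (hfm measurableSet_Ici) (hofReal measurableSet_Iic ha)
    (hofReal measurableSet_Ici hb') fun x hx y hy => ?_
  have hxa : f x ≤ a := hx
  have hyb : b ≤ f y := hy
  rw [edist_dist]
  refine ENNReal.ofReal_le_ofReal ?_
  have h3 : dist (f x) (f y) ≤ dist x y := by simpa using hf.dist_le_mul x y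
  rw [Real.dist_eq, abs_sub_comm] at h3
  linarith [le_abs_self (f y - f x)]

/-- The distance function of one of two separated sets detects the separation: a set of mass at
least `1 - κ'` meets the image of every set of mass more than `κ'`, hence the images of both. -/
theorem sep_le_obsDiam (X : MMSpace) {κ : Fin 2 → ℝ} {κ' : ℝ} (h0 : 0 ≤ κ')
    (hκ : ∀ i, κ' < κ i) : X.sep κ ≤ X.obsDiam κ' := by
  refine le_of_forall_lt fun r hr => ?_
  obtain ⟨r', hrr', hr'⟩ := exists_between hr
  obtain ⟨A, B, hA, hB, hκA, hκB, hAB⟩ := exists_sets_of_lt_sep hr'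
  refine hrr'.trans_le ?_
  have hf : LipschitzWith 1 fun x : X => Metric.infDist x A := Metric.lipschitz_infDist_pt A
  have hfm := hf.continuous.measurable
  refine le_iSup₂_of_le _ hf (le_iInf fun C => le_iInf₂ fun hC hμC => ?_)
  rw [Measure.map_apply hfm hC] at hμC
  have meets : ∀ {S : Set X} {c : ℝ}, ENNReal.ofReal c ≤ X.μ S → κ' < c →
      ∃ x ∈ S, Metric.infDist x A ∈ C := fun {S c} hS hc => by
    by_contra! h
    have h1 : S ⊆ ((fun x : X => Metric.infDist x A) ⁻¹' C)ᶜ := fun x hx => h x hx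
    have h2 := hS.trans (measure_mono h1)
    rw [prob_compl_eq_one_sub (hfm hC)] at h2
    have h3 : ENNReal.ofReal c ≤ ENNReal.ofReal κ' := by
      refine h2.trans ((tsub_le_tsub_left hμC 1).trans ?_)
      rw [tsub_le_iff_right, ← ENNReal.ofReal_one]
      refine le_trans (ENNReal.ofReal_le_ofReal ?_) ENNReal.ofReal_add_le
      linarith
    exact absurd ((ENNReal.ofReal_le_ofReal_iff h0).1 h3) (not_le.2 hc)
  obtain ⟨x, hxA, hxC⟩ := meets hκA (hκ 0)
  obtain ⟨y, hyB, hyC⟩ := meets hκB (hκ 1)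
  refine le_trans ?_ (Metric.edist_le_ediam_of_mem hyC hxC)
  have hr't : r' ≠ ∞ := ((hAB x hxA y hyB).trans_le le_top).ne
  rw [Metric.infDist_zero_of_mem hxA, edist_dist, Real.dist_eq, sub_zero,
    abs_of_nonneg Metric.infDist_nonneg, ENNReal.le_ofReal_iff_toReal_le hr't Metric.infDist_nonneg]
  refine (Metric.le_infDist ⟨x, hxA⟩).2 fun z hz => ?_
  have h4 := (hAB z hz y hyB).le
  rw [edist_comm, edist_dist, ENNReal.le_ofReal_iff_toReal_le hr't dist_nonneg] at h4
  exact h4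

end MMSpace

/-! ### Observable diameter and separation distance of a family -/

namespace Pyramid

theorem iSup_sep_le_sep (P : Set MMSpace) {N : ℕ} (κ : Fin (N + 1) → ℝ) :
    ⨆ X ∈ P, X.sep κ ≤ sep P κ := by
  refine ge_of_tendsto (tendsto_sep P κ) ?_
  filter_upwards [self_mem_nhdsWithin] with δ hδ
  exact iSup₂_mono fun X _ => X.sep_antitone fun i => sub_le_self _ (le_of_lt hδ)

theorem sep_le_iSup_sep (P : Set MMSpace) {N : ℕ} (κ : Fin (N + 1) → ℝ) {δ : ℝ} (hδ : 0 < δ) :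
    sep P κ ≤ ⨆ X ∈ P, X.sep fun i => κ i - δ := by
  refine le_of_tendsto (tendsto_sep P κ) ?_
  filter_upwards [Ioo_mem_nhdsGT hδ] with δ' hδ'
  exact iSup₂_mono fun X _ => X.sep_antitone fun i => sub_le_sub_left hδ'.2.le _

theorem obsDiam_le_iSup_obsDiam (P : Set MMSpace) (κ : ℝ) :
    obsDiam P κ ≤ ⨆ X ∈ P, X.obsDiam κ := by
  refine le_of_tendsto (tendsto_obsDiam P κ) ?_
  filter_upwards [self_mem_nhdsWithin] with δ hδ
  exact iSup₂_mono fun X _ => X.obsDiam_antitone (le_add_of_nonneg_right (le_of_lt hδ))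

theorem iSup_obsDiam_le_obsDiam (P : Set MMSpace) {κ κ' : ℝ} (h : κ < κ') :
    ⨆ X ∈ P, X.obsDiam κ' ≤ obsDiam P κ := by
  refine ge_of_tendsto (tendsto_obsDiam P κ) ?_
  filter_upwards [Ioo_mem_nhdsGT (sub_pos.2 h)] with δ hδ
  exact iSup₂_mono fun X _ => X.obsDiam_antitone (by linarith [hδ.2])

theorem obsDiam_le_sep (P : Set MMSpace) {κ : ℝ} (h0 : 0 < κ) (h1 : κ < 1) :
    obsDiam P κ ≤ sep P fun _ : Fin 2 => κ / 2 :=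
  (obsDiam_le_iSup_obsDiam P κ).trans <|
    (iSup₂_mono fun X _ => X.obsDiam_le_sep h0 h1).trans (iSup_sep_le_sep P _)

theorem obsDiam_antitone (P : Set MMSpace) : Antitone (obsDiam P) := by
  intro κ κ' h
  rcases h.eq_or_lt with rfl | h
  · exact le_rfl
  · exact (obsDiam_le_iSup_obsDiam P κ').trans (iSup_obsDiam_le_obsDiam P h)

theorem sep_le_obsDiam (P : Set MMSpace) {κ : Fin 2 → ℝ} {κ' : ℝ} (h0 : 0 < κ')
    (hκ : ∀ i, κ' < κ i) : sep P κ ≤ obsDiam P (κ' / 4) := by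
  -- The thresholds are ordered as `κ' / 4 < κ' / 3 < κ i - κ' / 2`.
  refine (sep_le_iSup_sep P κ (half_pos h0)).trans <| (iSup₂_mono fun X _ =>
    X.sep_le_obsDiam (κ' := κ' / 3) (by linarith) fun i => ?_).trans
      (iSup_obsDiam_le_obsDiam P (by linarith))
  linarith [hκ i]

theorem tendsto_obsDiam_of_isLevyFamily {P : ℕ → Set MMSpace} (h : IsLevyFamily P) {κ : ℝ}
    (hκ : 0 < κ) : Tendsto (fun n => obsDiam (P n) κ) atTop (𝓝 0) := by
  have h0 : 0 < min κ (1 / 2) := lt_min hκ (by norm_num)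
  have h1 : min κ (1 / 2) ≤ 1 / 2 := min_le_right _ _
  refine tendsto_of_tendsto_of_tendsto_of_le_of_le tendsto_const_nhds
    (h (fun _ => min κ (1 / 2) / 2) (fun _ => half_pos h0) ?_) (fun _ => zero_le) fun n => ?_
  · rw [Fin.sum_univ_two]
    linarith
  · exact (obsDiam_antitone (P n) (min_le_left _ _)).trans
      (obsDiam_le_sep (P n) h0 (by linarith))

theorem isLevyFamily_of_tendsto_obsDiam {P : ℕ → Set MMSpace}
    (h : ∀ κ : ℝ, 0 < κ → Tendsto (fun n => obsDiam (P n) κ) atTop (𝓝 0)) : IsLevyFamily P := by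
  intro κ hκ _
  have h0 : 0 < min (κ 0) (κ 1) / 2 := half_pos (lt_min (hκ 0) (hκ 1))
  refine tendsto_of_tendsto_of_tendsto_of_le_of_le tendsto_const_nhds (h _ (by positivity))
    (fun _ => zero_le) fun n => sep_le_obsDiam (P n) h0 fun i => ?_
  fin_cases i
  · exact (half_lt_self (lt_min (hκ 0) (hκ 1))).trans_le (min_le_left _ _)
  · exact (half_lt_self (lt_min (hκ 0) (hκ 1))).trans_le (min_le_right _ _)

end Pyramid

/-! ### Weak convergence of a Lévy family -/

namespace MMSpace

/-- A set of parameters pushes forward to a Borel set, namely the closure of its image, of at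
least the same measure. -/
theorem IsParameter.le_measure_closure {X : MMSpace} {φ : Ico (0 : ℝ) 1 → X}
    (hφ : X.IsParameter φ) (S : Set (Ico (0 : ℝ) 1)) :
    lebesgueI S ≤ X.μ (closure (φ '' S)) := by
  rw [← hφ.2, Measure.map_apply hφ.1 isClosed_closure.measurableSet]
  exact measure_mono fun s hs => subset_closure (mem_image_of_mem φ hs)

theorem le_edist_of_mem_closure {S : Type*} [PseudoEMetricSpace S] {A B : Set S} {r : ℝ≥0∞}
    (h : ∀ x ∈ A, ∀ y ∈ B, r ≤ edist x y) : ∀ x ∈ closure A, ∀ y ∈ closure B, r ≤ edist x y := by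
  intro x hx y hy
  have hcl : IsClosed {p : S × S | r ≤ edist p.1 p.2} :=
    isClosed_le continuous_const (continuous_fst.edist continuous_snd)
  have hxy : (x, y) ∈ closure (A ×ˢ B) := by
    rw [closure_prod_eq]
    exact ⟨hx, hy⟩
  exact closure_minimal (fun p hp => h p.1 hp.1 p.2 hp.2) hcl hxy

/-- A space with two points has two separated balls of positive measure, and these are carried to
separated sets of every space that is close to it. -/
theorem exists_le_sep_of_box_lt {X : MMSpace} (hX : ¬ Subsingleton X) :
    ∃ κ r ε : ℝ, 0 < κ ∧ κ < 1 / 2 ∧ 0 < r ∧ 0 < ε ∧ ∀ Y : MMSpace,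
      X.box Y < ENNReal.ofReal ε → ENNReal.ofReal r ≤ Y.sep fun _ : Fin 2 => κ := by
  rw [not_subsingleton_iff_nontrivial] at hX
  obtain ⟨a, b, hab⟩ := hX
  set r := dist a b / 4 with hr
  have hr0 : 0 < r := div_pos (dist_pos.2 hab) (by norm_num)
  have hpos : ∀ c : X, 0 < X.μ.real (Metric.ball c r) := fun c =>
    ENNReal.toReal_pos (Metric.measure_ball_pos X.μ c hr0).ne' (measure_ne_top _ _)
  set κ := min (X.μ.real (Metric.ball a r)) (X.μ.real (Metric.ball b r)) / 3 with hκ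
  have hκ0 : 0 < κ := div_pos (lt_min (hpos a) (hpos b)) (by norm_num)
  have hκ1 : κ < 1 / 2 := by
    have : 3 * κ ≤ 1 := by
      rw [hκ, mul_div_cancel₀ _ (by norm_num)]
      exact (min_le_left _ _).trans measureReal_le_one
    linarith
  refine ⟨κ, r, min κ r, hκ0, hκ1, hr0, lt_min hκ0 hr0, fun Y hY => ?_⟩
  simp only [box, iInf_lt_iff] at hY
  obtain ⟨ε, ⟨φ, ψ, I₀, hφ, hψ, hI, hdist, hvol⟩, hε⟩ := hY
  rw [← ENNReal.ofReal_coe_nnreal, ENNReal.ofReal_lt_ofReal_iff (lt_min hκ0 hr0), lt_min_iff] at hε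
  have mass : ∀ c : X, 3 * κ ≤ X.μ.real (Metric.ball c r) →
      ENNReal.ofReal κ ≤ Y.μ (closure (ψ '' (φ ⁻¹' Metric.ball c r ∩ I₀))) := fun c hc => by
    refine le_trans ?_ (hψ.le_measure_closure _)
    refine ENNReal.ofReal_le_of_le_toReal (?_ : κ ≤ lebesgueI.real _)
    have h1 : X.μ.real (Metric.ball c r) = lebesgueI.real (φ ⁻¹' Metric.ball c r) := by
      rw [measureReal_def, ← hφ.2, Measure.map_apply hφ.1 measurableSet_ball, measureReal_def]
    have h2 : 1 - (ε : ℝ) ≤ lebesgueI.real I₀ :=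
      (ENNReal.ofReal_le_iff_le_toReal (measure_ne_top _ _)).1 hvol
    have h3 : lebesgueI.real (φ ⁻¹' Metric.ball c r) ≤
        lebesgueI.real (φ ⁻¹' Metric.ball c r ∩ I₀) + lebesgueI.real I₀ᶜ :=
      (measureReal_mono fun s hs => (em (s ∈ I₀)).imp (fun h => ⟨hs, h⟩) id).trans
        (measureReal_union_le _ _)
    rw [probReal_compl_eq_one_sub hI] at h3
    linarith [hε.1]
  refine le_sep isClosed_closure.measurableSet isClosed_closure.measurableSet
    (mass a ?_) (mass b ?_) (le_edist_of_mem_closure ?_)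
  · rw [hκ, mul_div_cancel₀ _ (by norm_num)]
    exact min_le_left _ _
  · rw [hκ, mul_div_cancel₀ _ (by norm_num)]
    exact min_le_right _ _
  · rintro _ ⟨s, ⟨hsa, hs⟩, rfl⟩ _ ⟨t, ⟨htb, ht⟩, rfl⟩
    rw [edist_dist]
    refine ENNReal.ofReal_le_ofReal ?_
    have h1 := (abs_le.1 (hdist s hs t ht)).2
    have h2 : dist (φ s) a < r := hsa
    have h3 : dist (φ t) b < r := htb
    have h4 := dist_triangle4 a (φ s) (φ t) b
    rw [dist_comm a (φ s)] at h4
    linarith [hε.2]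

theorem box_self_of_subsingleton {X : MMSpace} (hX : Subsingleton X) : X.box X = 0 := by
  refine le_antisymm (iInf₂_le_of_le 0 ?_ (by simp)) zero_le
  obtain ⟨x⟩ := nonempty_of_isProbabilityMeasure X.μ
  have hx : X.IsParameter fun _ => x := by
    refine ⟨measurable_const, ?_⟩
    have hμ : X.μ = Measure.dirac x := by
      refine Measure.ext fun s _ => ?_
      rcases Subsingleton.eq_empty_or_singleton (Set.subsingleton_of_subsingleton (s := s))
        with rfl | ⟨y, rfl⟩
      · simp
      · rw [Subsingleton.elim y x, show ({x} : Set X) = univ from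
          eq_univ_of_forall fun z => Subsingleton.elim z x, measure_univ, measure_univ]
    rw [Measure.map_const, measure_univ, one_smul, hμ]
  exact ⟨_, _, univ, hx, hx, MeasurableSet.univ, by simp, by simp⟩

end MMSpace

namespace Pyramid

theorem convergesWeakly_of_isLevyFamily {P : ℕ → Set MMSpace} (hP : ∀ n, IsPyramid (P n))
    (h : IsLevyFamily P) : ConvergesWeakly P point.associated := by
  refine ⟨fun X hX => ?_, fun X hX => ?_⟩
  · rw [mem_associated_point] at hX
    have h0 : ∀ n, boxToSet X (P n) = 0 := fun n => by
      obtain ⟨Z, hZ⟩ := (hP n).nonempty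
      have hXP : X ∈ P n := by
        -- A constant map exhibits `X ≺ Z`, by way of the one-point space.
        obtain ⟨f, hfl, hf⟩ := (mem_associated_point X).2 hX
        refine (hP n).mem_of_dominates Z hZ X
          ⟨fun _ => f (), LipschitzWith.const' (f ()), ?_⟩
        rw [← hf, Measure.map_const, measure_univ, one_smul]
        exact (Measure.map_dirac' hfl.continuous.measurable ()).symm
      exact le_antisymm ((iInf₂_le X hXP).trans (box_self_of_subsingleton hX).le) zero_le
    simp only [h0]
    exact tendsto_const_nhds
  · rw [mem_associated_point] at hX
    obtain ⟨κ, r, ε, hκ0, hκ1, hr, hε, hsep⟩ := exists_le_sep_of_box_lt hX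
    by_contra! hlim
    have hfreq : ∃ᶠ n in atTop, boxToSet X (P n) < ENNReal.ofReal ε :=
      frequently_lt_of_liminf_lt (by isBoundedDefault)
        (hlim.trans_lt (ENNReal.ofReal_pos.2 hε))
    have hlt : ∀ᶠ n in atTop, sep (P n) (fun _ : Fin 2 => κ) < ENNReal.ofReal r :=
      (h (fun _ => κ) (fun _ => hκ0) (by rw [Fin.sum_univ_two]; linarith)).eventually
        (gt_mem_nhds (ENNReal.ofReal_pos.2 hr))
    obtain ⟨n, hn, hn'⟩ := (hfreq.and_eventually hlt).exists
    simp only [boxToSet, iInf_lt_iff] at hn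
    obtain ⟨Y, hY, hXY⟩ := hn
    refine absurd hn' (not_lt.2 ((hsep Y hXY).trans ?_))
    exact (le_iSup₂ (f := fun (X : MMSpace) (_ : X ∈ P n) => X.sep fun _ : Fin 2 => κ) Y hY).trans
      (iSup_sep_le_sep (P n) _)

end Pyramid

/-! ### Families with separated sets have a nontrivial limit -/

namespace MMSpace

/-- Two sets of mass at least `c` at distance more than `r` yield, through the truncated distance
function of one of them, a dominated space on `[0, r]` with atoms of mass at least `c` at both
ends. -/
theorem exists_dominates_ofMeasure_of_lt_sep {X : MMSpace} {κ : Fin 2 → ℝ} {c r : ℝ}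
    (hc : 0 < c) (hκ : ∀ i, c ≤ κ i) (hr : 0 ≤ r) (h : ENNReal.ofReal r < X.sep κ) :
    ∃ (ν : Measure ℝ) (_ : IsProbabilityMeasure ν), X.Dominates (ofMeasure ν) ∧
      ν (Iio 0) = 0 ∧ ν (Ioi r) = 0 ∧ c ≤ ν.real {0} ∧ c ≤ ν.real {r} := by
  obtain ⟨A, B, -, -, hκA, hκB, hAB⟩ := exists_sets_of_lt_sep h
  have hf : LipschitzWith 1 fun x : X => min (Metric.infDist x A) r :=
    (Metric.lipschitz_infDist_pt A).min_const r
  have hfm := hf.continuous.measurable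
  have hA : A.Nonempty := by
    refine nonempty_of_measure_ne_zero (μ := X.μ) (ne_of_gt (lt_of_lt_of_le ?_ hκA))
    exact ENNReal.ofReal_pos.2 (hc.trans_le (hκ 0))
  refine ⟨Measure.map (fun x : X => min (Metric.infDist x A) r) X.μ,
    Measure.isProbabilityMeasure_map hfm.aemeasurable, ?_, ?_, ?_, ?_, ?_⟩
  · have := Measure.isProbabilityMeasure_map (μ := X.μ) hfm.aemeasurable
    exact X.dominates_ofMeasure hf rfl
  · rw [Measure.map_apply hfm measurableSet_Iio]
    convert measure_empty (μ := X.μ)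
    refine eq_empty_of_forall_notMem fun x hx => ?_
    exact absurd (le_min Metric.infDist_nonneg hr) (not_le.2 hx)
  · rw [Measure.map_apply hfm measurableSet_Ioi]
    convert measure_empty (μ := X.μ)
    refine eq_empty_of_forall_notMem fun x hx => ?_
    exact absurd (min_le_right (Metric.infDist x A) r) (not_le.2 hx)
  · rw [map_measureReal_apply hfm (measurableSet_singleton _)]
    have h1 : κ 0 ≤ X.μ.real A := (ENNReal.ofReal_le_iff_le_toReal (measure_ne_top _ _)).1 hκA
    refine (hκ 0).trans (h1.trans (measureReal_mono fun x hx => ?_))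
    simpa [Metric.infDist_zero_of_mem hx] using hr
  · rw [map_measureReal_apply hfm (measurableSet_singleton _)]
    have h1 : κ 1 ≤ X.μ.real B := (ENNReal.ofReal_le_iff_le_toReal (measure_ne_top _ _)).1 hκB
    refine (hκ 1).trans (h1.trans (measureReal_mono fun y hy => ?_))
    refine min_eq_right ((Metric.le_infDist hA).2 fun x hx => ?_)
    have h2 := (hAB x hx y hy).le
    rw [edist_dist, dist_comm] at h2
    exact (ENNReal.ofReal_le_ofReal_iff dist_nonneg).1 h2

/-- A sequence of laws on `[0, r]` with atoms of mass at least `c` at both ends has a subsequence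
converging in box distance to a space with at least two points.  Helly's theorem provides an almost
everywhere limit of the quantile functions, which equals `0` before `c` and `r` after `1 - c`. -/
theorem exists_subseq_box_tendsto {ν : ℕ → Measure ℝ} [∀ n, IsProbabilityMeasure (ν n)] {c r : ℝ}
    (hc : 0 < c) (hr : 0 < r) (h0 : ∀ n, ν n (Iio 0) = 0) (h1 : ∀ n, ν n (Ioi r) = 0)
    (hc0 : ∀ n, c ≤ (ν n).real {0}) (hcr : ∀ n, c ≤ (ν n).real {r}) :
    ∃ (φ : ℕ → ℕ) (X : MMSpace), StrictMono φ ∧ ¬ Subsingleton X ∧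
      ∀ ε : ℝ≥0, 0 < ε → ∀ᶠ n in atTop, X.box (ofMeasure (ν (φ n))) ≤ ε := by
  obtain ⟨φ, g, hφ, hg, hlim⟩ := exists_subseq_tendsto_ae_of_monotone
    (q := fun n t => quantile (ν n) t) (r := r) (fun n => quantile_monotone (ν n) (h0 n))
    fun n t => ⟨quantile_nonneg _ (h0 n) t.2.1 t.2.2,
      quantile_le_of_measure_Ioi _ hr.le (h1 n) t.2.1 t.2.2⟩
  have hgm : Measurable g := hg.measurable
  have : IsProbabilityMeasure (Measure.map g lebesgueI) :=
    Measure.isProbabilityMeasure_map hgm.aemeasurable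
  have hqm : ∀ n, Measurable fun t : Ico (0 : ℝ) 1 => quantile (ν n) t := fun n =>
    (quantile_monotone (ν n) (h0 n)).measurable
  refine ⟨φ, ofMeasure (Measure.map g lebesgueI), hφ, fun hsub => ?_, fun ε hε => ?_⟩
  · have hsupp : ∀ᵐ t ∂lebesgueI, g t ∈ (Measure.map g lebesgueI).support :=
      ae_of_ae_map hgm.aemeasurable (p := fun x => x ∈ (Measure.map g lebesgueI).support)
        Measure.support_mem_ae
    have hc1 : c ≤ 1 := (hc0 0).trans measureReal_le_one
    obtain ⟨s, hs0, hsc, hslim, hs⟩ := exists_mem_of_ae_lebesgueI (hlim.and hsupp) le_rfl hc1 hc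
    obtain ⟨t, htc, -, htlim, ht⟩ := exists_mem_of_ae_lebesgueI (hlim.and hsupp)
      (a := 1 - c) (b := 1) (by linarith) le_rfl (by linarith)
    have ht0 : (0 : ℝ) < t := by linarith
    have hgs : g s ≤ 0 := le_of_tendsto' hslim fun n =>
      quantile_le_of_le_measure_singleton _ (hc0 _) hs0 s.2.2 hsc.le
    have hgt : r ≤ g t := ge_of_tendsto' htlim fun n =>
      le_quantile_of_le_measure_singleton _ (hcr _) ht0 t.2.2 htc
    have hst : (⟨g s, hs⟩ : (Measure.map g lebesgueI).support) = ⟨g t, ht⟩ := hsub.elim _ _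
    rw [Subtype.mk.injEq] at hst
    linarith
  · have hmeas := tendstoInMeasure_of_tendsto_ae
      (fun n => (hqm (φ n)).aestronglyMeasurable (μ := lebesgueI)) hlim
    rw [tendstoInMeasure_iff_dist] at hmeas
    filter_upwards [(hmeas (ε / 2) (by positivity)).eventually
      (ge_mem_nhds (ENNReal.coe_pos.2 hε))] with n hn
    exact box_ofMeasure_le hgm (hqm _) rfl (map_quantile _ (h0 _)) hn

end MMSpace

namespace Pyramid

theorem isLevyFamily_of_convergesWeakly {P : ℕ → Set MMSpace} (hP : ∀ n, IsPyramid (P n))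
    (h : ConvergesWeakly P point.associated) : IsLevyFamily P := by
  intro κ hκ _
  by_contra hlim
  obtain ⟨c, hc0, hc⟩ : ∃ c, 0 < c ∧ ∀ i, c ≤ κ i - c := by
    refine ⟨min (κ 0) (κ 1) / 2, half_pos (lt_min (hκ 0) (hκ 1)), fun i => ?_⟩
    fin_cases i
    · change _ ≤ κ 0 - _
      linarith [min_le_left (κ 0) (κ 1)]
    · change _ ≤ κ 1 - _
      linarith [min_le_right (κ 0) (κ 1)]
  rw [ENNReal.tendsto_nhds_zero] at hlim
  push Not at hlim
  obtain ⟨r', hr', hfreq⟩ := hlim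
  obtain ⟨r, hr0, hrr'⟩ := ENNReal.lt_iff_exists_nnreal_btwn.1 hr'
  obtain ⟨θ, hθ, hsep⟩ := extraction_of_frequently_atTop hfreq
  have hline : ∀ n, ∃ (ν : Measure ℝ) (_ : IsProbabilityMeasure ν), ofMeasure ν ∈ P (θ n) ∧
      ν (Iio 0) = 0 ∧ ν (Ioi (r : ℝ)) = 0 ∧ c ≤ ν.real {0} ∧ c ≤ ν.real {(r : ℝ)} := fun n => by
    have h1 := (hrr'.trans (hsep n)).trans_le (sep_le_iSup_sep (P (θ n)) κ hc0)
    simp only [lt_iSup_iff] at h1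
    obtain ⟨X, hX, hlt⟩ := h1
    rw [← ENNReal.ofReal_coe_nnreal] at hlt
    obtain ⟨ν, hν, hdom, hrest⟩ := exists_dominates_ofMeasure_of_lt_sep hc0 hc r.2 hlt
    exact ⟨ν, hν, (hP _).mem_of_dominates X hX _ hdom, hrest⟩
  choose ν hν hmem hν0 hνr hνc0 hνcr using hline
  obtain ⟨φ, X, hφ, hX, hbox⟩ := exists_subseq_box_tendsto hc0
    (NNReal.coe_pos.2 (ENNReal.coe_pos.1 hr0)) hν0 hνr hνc0 hνcr
  have hpos := h.2 X fun hmem => hX ((mem_associated_point X).1 hmem)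
  obtain ⟨ε, hε0, hε⟩ := ENNReal.lt_iff_exists_nnreal_btwn.1 hpos
  have hev : ∀ᶠ n in atTop, (ε : ℝ≥0∞) < boxToSet X (P n) :=
    eventually_lt_of_lt_liminf hε (by isBoundedDefault)
  obtain ⟨n, hn, hn'⟩ := (((hθ.comp hφ).tendsto_atTop.eventually hev).and
    (hbox ε (ENNReal.coe_pos.1 hε0))).exists
  exact absurd hn (not_lt.2 ((iInf₂_le _ (hmem (φ n))).trans hn'))

end Pyramid

theorem corollary5 (P : ℕ → Set MMSpace) (hP : ∀ n, IsPyramid (P n)) :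
    List.TFAE [
      Pyramid.IsLevyFamily P,
      Pyramid.ConvergesWeakly P MMSpace.point.associated,
      ∀ κ : ℝ, 0 < κ → Tendsto (fun n => Pyramid.obsDiam (P n) κ) atTop (𝓝 0)] := by
  tfae_have 1 → 2 := Pyramid.convergesWeakly_of_isLevyFamily hP
  tfae_have 2 → 1 := Pyramid.isLevyFamily_of_convergesWeakly hP
  tfae_have 1 → 3 := fun h κ hκ => Pyramid.tendsto_obsDiam_of_isLevyFamily h hκ
  tfae_have 3 → 1 := Pyramid.isLevyFamily_of_tendsto_obsDiam
  tfae_finish
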